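/- Let $\beta=(\beta_w)_{|w|\le 4}$ be real numbers indexed by the words $w$ of length at most $4$ in two noncommuting letters $X,Y$, with $\beta_v=\beta_w$ whenever $v$ is a cyclic permutation of $w$, $\beta_w=\beta_{w^*}$ ($w^*$ is the reversed word), and $\beta_1=1$. Assume that $\beta$ is noncommutative, i.e. $\beta_{X^2Y^2}\neq\beta_{XYXY}$. Let $\mathcal M_2=(\beta_{U^*V})_{|U|,|V|\le 2}$ be its moment matrix, with columns denoted by $\mathbb 1,\mathbb X,\mathbb Y,\mathbb X^2,\mathbb X\mathbb Y,\mathbb Y\mathbb X,\mathbb Y^2$. A representing measure for $\beta$ consists of finitely many pairs $(A_i,B_i)$ of real symmetric $t_i\times t_i$ matrices, $t_i\ge1$ (atoms of size $t_i$), and densities $\lambda_i>0$ with $\sum_i\lambda_i=1$, such that $\beta_w=\sum_i\lambda_i\frac1{t_i}\operatorname{tr}\,w(A_i,B_i)$ for all $|w|\le 4$. It is of type $(m_1,\dots,m_r)$ if it has exactly $m_s$ atoms of size $s$ for $1\le s\le r$, none of size larger than $r$, and $m_r\ne0$. It is minimal if no representing measure has a type $(m_1',\dots,m_{r'}')$ with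 $r'<r$, or with $r'=r$ and, for some $1\le s\le r$, $m_s'<m_s$ and $m_t'=m_t$ for all $s<t\le r$. The sequence $\beta$ admits a noncommutative (nc) measure if it has a minimal measure with $r>1$. Uniqueness of a measure is understood up to reordering the atoms and replacing each $(A_i,B_i)$ by $(U_iA_iU_i^t,U_iB_iU_i^t)$ with $U_i$ orthogonal. Suppose that $\mathcal M_2$ has rank $5$ and satisfies the column relations $\mathbb X\mathbb Y+\mathbb Y\mathbb X=\mathbf 0$ and $\mathbb Y^2-\mathbb X^2=\mathbb 1$. Then $\beta$ admits an nc measure exactly in the following cases: 1. $\mathcal M_2$ is positive semidefinite and $\beta_X=\beta_Y=0$. In this case the minimal measure exists, is unique, and is of type $(2,1)$. 2. $\mathcal M_2$ is positive semidefinite and $$\beta_X=0,\qquad 0<|\beta_Y|<1,\qquad \beta_{X^4}\ge\frac{\beta_{X^2}^2}{1-|\beta_Y|}.$$ In this case the minimal measure exists and is unique. It is of type $(1,1)$ if and only if $\beta_{X^4}=\frac{\beta_{X^2}^2}{1-|\beta_Y|}$; otherwise it is of type $(2,1)$. -/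

import Mathlib

namespace BQTMP

/-- The two noncommuting letters. -/
inductive Letter
  | X
  | Y
  deriving DecidableEq

open Letter

/-- Words of length at most `k` in `X, Y`; the empty word is the unit `1`. -/
abbrev WordLE (k : ℕ) : Type := {w : List Letter // w.length ≤ k}

/-- A sequence `β = (β_w)_{|w| ≤ 4}` with `β_v = β_w` whenever `v` is a cyclic permutation of `w`
and `β_w = β_{w*}`, where `w*` is the reverse of `w`. -/
structure TracialSeq where
  toFun : WordLE 4 → ℝ
  cyclic : ∀ v w : WordLE 4, v.1.IsRotated w.1 → toFun v = toFun w
  star : ∀ v w : WordLE 4, w.1 = v.1.reverse → toFun v = toFun w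

/-- The moment `β_w`. -/
def TracialSeq.moment (β : TracialSeq) (w : List Letter) (h : w.length ≤ 4 := by decide) : ℝ :=
  β.toFun ⟨w, h⟩

/-- `β` is normalized if `β_1 = 1`. -/
def TracialSeq.Normalized (β : TracialSeq) : Prop := β.moment [] = 1

/-- `β` is a noncommutative sequence if `β_{X²Y²} ≠ β_{XYXY}`. -/
def TracialSeq.Noncommutative (β : TracialSeq) : Prop :=
  β.moment [X, X, Y, Y] ≠ β.moment [X, Y, X, Y]

/-- The words of length at most two in degree-lexicographic order. -/
def basisWord : Fin 7 → WordLE 2 :=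
  ![⟨[], by decide⟩, ⟨[X], by decide⟩, ⟨[Y], by decide⟩, ⟨[X, X], by decide⟩,
    ⟨[X, Y], by decide⟩, ⟨[Y, X], by decide⟩, ⟨[Y, Y], by decide⟩]

/-- The entry `β_{U* V}` for words `U, V` of length at most two. -/
def TracialSeq.entry (β : TracialSeq) (U V : WordLE 2) : ℝ :=
  β.moment (U.1.reverse ++ V.1) (by
    have hU := U.2
    have hV := V.2
    simp only [List.length_append, List.length_reverse]
    omega)

/-- The truncated moment matrix `M₂` of order two. -/
def TracialSeq.M₂ (β : TracialSeq) : Matrix (Fin 7) (Fin 7) ℝ :=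
  Matrix.of fun i j => β.entry (basisWord i) (basisWord j)

/-- The column of `M₂` indexed by the word `w`. -/
def TracialSeq.column (β : TracialSeq) (w : List Letter) (h : w.length ≤ 2 := by decide) :
    Fin 7 → ℝ :=
  fun i => β.entry (basisWord i) ⟨w, h⟩

/-- An atom: a pair of real symmetric matrices of the same positive size. -/
structure Atom where
  size : ℕ
  size_pos : 0 < size
  A : Matrix (Fin size) (Fin size) ℝ
  B : Matrix (Fin size) (Fin size) ℝ
  symmA : A.IsSymm
  symmB : B.IsSymm

/-- The matrix `w(A, B)`. -/
def Atom.eval (a : Atom) (w : List Letter) : Matrix (Fin a.size) (Fin a.size) ℝ :=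
  (w.map fun l => match l with
    | X => a.A
    | Y => a.B).prod

/-- The normalized trace of `w(A, B)`. -/
noncomputable def Atom.trace (a : Atom) (w : List Letter) : ℝ :=
  (a.eval w).trace / (a.size : ℝ)

/-- Orthogonal equivalence of atoms. The two identities `U Uᵗ = 1`, `Uᵗ U = 1` force the sizes
to agree, so `U` is an orthogonal matrix. -/
def Atom.OrthEquiv (a b : Atom) : Prop :=
  ∃ U : Matrix (Fin b.size) (Fin a.size) ℝ,
    U * U.transpose = 1 ∧ U.transpose * U = 1 ∧
      b.A = U * a.A * U.transpose ∧ b.B = U * a.B * U.transpose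

/-- A finitely atomic measure: finitely many atoms with positive densities of total mass one. -/
structure AtomicMeasure where
  N : ℕ
  atom : Fin N → Atom
  density : Fin N → ℝ
  density_pos : ∀ i, 0 < density i
  density_sum : ∑ i, density i = 1

namespace AtomicMeasure

/-- `μ` is a representing measure for `β`. -/
def Represents (μ : AtomicMeasure) (β : TracialSeq) : Prop :=
  ∀ w : WordLE 4, β.toFun w = ∑ i, μ.density i * (μ.atom i).trace w.1

/-- The number `m_s` of atoms of size `s`. -/
def mult (μ : AtomicMeasure) (s : ℕ) : ℕ :=
  (Finset.univ.filter fun i => (μ.atom i).size = s).card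

/-- The largest size `r` of an atom. -/
def maxSize (μ : AtomicMeasure) : ℕ :=
  Finset.univ.sup fun i => (μ.atom i).size

/-- The type `(m_1, …, m_r)`. -/
def type (μ : AtomicMeasure) : List ℕ :=
  (List.range μ.maxSize).map fun s => μ.mult (s + 1)

/-- The type `(m_1, …, m_r)` of `μ` is strictly smaller than the type `(m'_1, …, m'_{r'})` of `ν`:
either `r < r'`, or `r = r'` and for some `1 ≤ s ≤ r` one has `m_s < m'_s`
and `m_t = m'_t` for all `s < t ≤ r`. -/
def Smaller (μ ν : AtomicMeasure) : Prop :=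
  μ.maxSize < ν.maxSize ∨
    (μ.maxSize = ν.maxSize ∧ ∃ s, 1 ≤ s ∧ s ≤ ν.maxSize ∧ μ.mult s < ν.mult s ∧
      ∀ t, s < t → t ≤ ν.maxSize → μ.mult t = ν.mult t)

/-- `μ` is a minimal representing measure for `β`. -/
def IsMinimal (μ : AtomicMeasure) (β : TracialSeq) : Prop :=
  μ.Represents β ∧ ∀ ν : AtomicMeasure, ν.Represents β → ¬ ν.Smaller μ

/-- Equality of measures up to the order of the atoms and orthogonal equivalence of each atom. -/
def OrthEquiv (μ ν : AtomicMeasure) : Prop :=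
  ∃ e : Fin μ.N ≃ Fin ν.N, ∀ i,
    ν.density (e i) = μ.density i ∧ (μ.atom i).OrthEquiv (ν.atom (e i))

end AtomicMeasure

/-- `β` admits a noncommutative measure: a minimal measure of type `(m_1, …, m_r)` with `r > 1`. -/
def TracialSeq.AdmitsNCMeasure (β : TracialSeq) : Prop :=
  ∃ μ : AtomicMeasure, μ.IsMinimal β ∧ 1 < μ.maxSize

/-- A minimal measure exists and is unique up to orthogonal equivalence. -/
def TracialSeq.HasUniqueMinimalMeasure (β : TracialSeq) : Prop :=
  ∃ μ : AtomicMeasure, μ.IsMinimal β ∧ ∀ ν : AtomicMeasure, ν.IsMinimal β → μ.OrthEquiv ν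

/-- The condition `β_X = 0`, `0 < |β_Y| < 1`, `β_{X⁴} ≥ β_{X²}² / (1 - |β_Y|)`. -/
def TracialSeq.CondTwo (β : TracialSeq) : Prop :=
  β.moment [X] = 0 ∧ 0 < |β.moment [Y]| ∧ |β.moment [Y]| < 1 ∧
    β.moment [X, X, X, X] ≥ β.moment [X, X] ^ 2 / (1 - |β.moment [Y]|)

end BQTMP

/-!
For symmetric `A`, `B` the relations `AB = -BA`, `B² = 1 + A²` make `B` invertible and swap the
eigenspaces of `A` for `α` and `-α`. Hence the irreducible atoms are the points `(0, ±1)` and, for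
`α > 0`, one pair of size two with `A = diag(α, -α)`. As `B⁻¹` anticommutes with `A`, the moments
`tr (B⁻¹ Aᵏ)` vanish for `k ≥ 1`, while `-1 ≤ B⁻¹ ≤ 1`. Therefore
`tr ((1 ± B⁻¹) (1 - s A²)²) ≥ 0` reads `|y| ≤ 1 - 2 s a + s² c` with `y = β_Y`, `a = β_{X²}`,
`c = β_{X⁴}`, and its discriminant gives the necessary condition `a² ≤ c (1 - |y|)`. Conversely, a
measure with the three irreducible atoms is determined by `y`, `a` and `c`: its parameter satisfies
`α² = c / a` and its weights are `(1 - q ± y) / 2` and `q = a² / c`, which are nonnegative exactly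
under that condition. The weight of one of the two points vanishes exactly in the case of equality.
-/

namespace BQTMP

open Letter Matrix

/-! ### Moments on the hyperbola -/

namespace TracialSeq

/-- The column relations `XY + YX = 0` and `Y² - X² = 1` of the moment matrix. -/
structure ColumnRelations (β : TracialSeq) : Prop where
  anticomm : β.column [X, Y] + β.column [Y, X] = 0
  sq_sub_sq : β.column [Y, Y] - β.column [X, X] = β.column []

theorem moment_rotate (β : TracialSeq) (v w : List Letter) (h : v ~r w := by decide)
    (hv : v.length ≤ 4 := by decide) (hw : w.length ≤ 4 := by decide) :
    β.moment v hv = β.moment w hw :=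
  β.cyclic _ _ h

/-- Representatives of the words of length at most four up to cyclic permutation. -/
def necklaces : List (WordLE 4) :=
  [⟨[], by decide⟩, ⟨[X], by decide⟩, ⟨[Y], by decide⟩,
    ⟨[X, X], by decide⟩, ⟨[X, Y], by decide⟩, ⟨[Y, Y], by decide⟩,
    ⟨[X, X, X], by decide⟩, ⟨[X, X, Y], by decide⟩, ⟨[X, Y, Y], by decide⟩,
    ⟨[Y, Y, Y], by decide⟩, ⟨[X, X, X, X], by decide⟩, ⟨[X, X, X, Y], by decide⟩,
    ⟨[X, X, Y, Y], by decide⟩, ⟨[X, Y, X, Y], by decide⟩, ⟨[X, Y, Y, Y], by decide⟩,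
    ⟨[Y, Y, Y, Y], by decide⟩]

theorem exists_necklace_isRotated (w : WordLE 4) : ∃ v ∈ necklaces, w.1 ~r v.1 := by
  obtain ⟨w, hw⟩ := w
  rcases w with _ | ⟨_ | _, _ | ⟨_ | _, _ | ⟨_ | _, _ | ⟨_ | _, _ | ⟨_, _⟩⟩⟩⟩⟩
  all_goals first | decide +revert | (exfalso; simp only [List.length_cons] at hw; omega)

theorem eq_of_necklaces {β γ : TracialSeq} (h : ∀ v ∈ necklaces, β.toFun v = γ.toFun v) :
    β = γ := by
  have htoFun : β.toFun = γ.toFun := by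
    funext w
    obtain ⟨v, hv, hwv⟩ := exists_necklace_isRotated w
    rw [β.cyclic w v hwv, γ.cyclic w v hwv, h v hv]
  cases β
  cases γ
  congr 1

namespace ColumnRelations

variable {β γ : TracialSeq} (hβ : β.ColumnRelations)
include hβ

theorem moment_XY : β.moment [X, Y] = 0 := by
  have row : β.moment [X, Y] + β.moment [Y, X] = 0 := congrFun hβ.anticomm 0
  linarith [β.moment_rotate [Y, X] [X, Y]]

theorem moment_YY : β.moment [Y, Y] = β.moment [] + β.moment [X, X] := by
  have row : β.moment [Y, Y] - β.moment [X, X] = β.moment [] := congrFun hβ.sq_sub_sq 0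
  linarith

theorem moment_XXY : β.moment [X, X, Y] = 0 := by
  have row : β.moment [X, X, Y] + β.moment [X, Y, X] = 0 := congrFun hβ.anticomm 1
  linarith [β.moment_rotate [X, Y, X] [X, X, Y]]

theorem moment_XYY : β.moment [X, Y, Y] = 0 := by
  have row : β.moment [Y, X, Y] + β.moment [Y, Y, X] = 0 := congrFun hβ.anticomm 2
  linarith [β.moment_rotate [Y, X, Y] [X, Y, Y], β.moment_rotate [Y, Y, X] [X, Y, Y]]

theorem moment_XXX : β.moment [X, X, X] = -β.moment [X] := by
  have row : β.moment [X, Y, Y] - β.moment [X, X, X] = β.moment [X] := congrFun hβ.sq_sub_sq 1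
  linarith [hβ.moment_XYY]

theorem moment_YYY : β.moment [Y, Y, Y] = β.moment [Y] := by
  have row : β.moment [Y, Y, Y] - β.moment [Y, X, X] = β.moment [Y] := congrFun hβ.sq_sub_sq 2
  linarith [β.moment_rotate [Y, X, X] [X, X, Y], hβ.moment_XXY]

theorem moment_XXXY : β.moment [X, X, X, Y] = 0 := by
  have row : β.moment [X, X, X, Y] + β.moment [X, X, Y, X] = 0 := congrFun hβ.anticomm 3
  linarith [β.moment_rotate [X, X, Y, X] [X, X, X, Y]]

theorem moment_XXYY : β.moment [X, X, Y, Y] = β.moment [X, X] + β.moment [X, X, X, X] := by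
  have row : β.moment [X, X, Y, Y] - β.moment [X, X, X, X] = β.moment [X, X] :=
    congrFun hβ.sq_sub_sq 3
  linarith

theorem moment_XYXY : β.moment [X, Y, X, Y] = -β.moment [X, X, Y, Y] := by
  have row : β.moment [Y, X, X, Y] + β.moment [Y, X, Y, X] = 0 := congrFun hβ.anticomm 4
  linarith [β.moment_rotate [Y, X, X, Y] [X, X, Y, Y], β.moment_rotate [Y, X, Y, X] [X, Y, X, Y]]

theorem moment_XYYY : β.moment [X, Y, Y, Y] = 0 := by
  have row : β.moment [Y, Y, X, Y] + β.moment [Y, Y, Y, X] = 0 := congrFun hβ.anticomm 6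
  linarith [β.moment_rotate [Y, Y, X, Y] [X, Y, Y, Y], β.moment_rotate [Y, Y, Y, X] [X, Y, Y, Y]]

theorem moment_YYYY : β.moment [Y, Y, Y, Y] = β.moment [Y, Y] + β.moment [X, X, Y, Y] := by
  have row : β.moment [Y, Y, Y, Y] - β.moment [Y, Y, X, X] = β.moment [Y, Y] :=
    congrFun hβ.sq_sub_sq 6
  linarith [β.moment_rotate [Y, Y, X, X] [X, X, Y, Y]]

theorem ext (hγ : γ.ColumnRelations) (h1 : β.moment [] = γ.moment [])
    (hX : β.moment [X] = γ.moment [X]) (hY : β.moment [Y] = γ.moment [Y])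
    (hXX : β.moment [X, X] = γ.moment [X, X])
    (hXXXX : β.moment [X, X, X, X] = γ.moment [X, X, X, X]) : β = γ := by
  have hYY : β.moment [Y, Y] = γ.moment [Y, Y] := by rw [hβ.moment_YY, hγ.moment_YY, h1, hXX]
  have hXXYY : β.moment [X, X, Y, Y] = γ.moment [X, X, Y, Y] := by
    rw [hβ.moment_XXYY, hγ.moment_XXYY, hXX, hXXXX]
  refine eq_of_necklaces ?_
  simp only [necklaces, List.forall_mem_cons]
  exact ⟨h1, hX, hY, hXX, hβ.moment_XY.trans hγ.moment_XY.symm, hYY,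
    hβ.moment_XXX.trans ((congrArg Neg.neg hX).trans hγ.moment_XXX.symm),
    hβ.moment_XXY.trans hγ.moment_XXY.symm, hβ.moment_XYY.trans hγ.moment_XYY.symm,
    hβ.moment_YYY.trans (hY.trans hγ.moment_YYY.symm), hXXXX,
    hβ.moment_XXXY.trans hγ.moment_XXXY.symm, hXXYY,
    hβ.moment_XYXY.trans ((congrArg Neg.neg hXXYY).trans hγ.moment_XYXY.symm),
    hβ.moment_XYYY.trans hγ.moment_XYYY.symm,
    hβ.moment_YYYY.trans ((congrArg₂ (· + ·) hYY hXXYY).trans hγ.moment_YYYY.symm),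
    fun v hv => nomatch hv⟩

end ColumnRelations

end TracialSeq

open scoped MatrixOrder in
theorem posDef_submatrix_of_linearIndependent_col {m n : Type*} [Finite m] [Finite n]
    {M : Matrix n n ℝ} (hM : M.PosSemidef) (f : m → n)
    (hf : LinearIndependent ℝ fun i => M.col (f i)) : (M.submatrix f f).PosDef := by
  classical
  cases nonempty_fintype m
  cases nonempty_fintype n
  obtain ⟨N, hN⟩ := CStarAlgebra.nonneg_iff_eq_star_mul_self.1 hM.nonneg
  have hinj : Function.Injective (N.submatrix id f).mulVec := by
    have hMf : M.submatrix id f = Nᴴ * N.submatrix id f := by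
      rw [hN]
      rfl
    refine .of_comp (f := Nᴴ.mulVec) ?_
    have hcomp : Nᴴ.mulVec ∘ (N.submatrix id f).mulVec = (M.submatrix id f).mulVec := by
      funext x
      rw [Function.comp_apply, mulVec_mulVec, hMf]
    rw [hcomp]
    exact mulVec_injective_iff.2 hf
  have hMff : M.submatrix f f = (N.submatrix id f)ᴴ * N.submatrix id f := by
    rw [hN]
    rfl
  exact hMff ▸ PosDef.conjTranspose_mul_self _ hinj

namespace TracialSeq

theorem ColumnRelations.linearIndependent_col {β : TracialSeq} (hβ : β.ColumnRelations)
    (hrank : β.M₂.rank = 5) :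
    LinearIndependent ℝ fun i : Fin 5 => β.M₂.col (i.castLE (by decide)) := by
  set b : Fin 5 → Fin 7 → ℝ := fun i => β.M₂.col (i.castLE (by decide))
  have hb (i) : b i ∈ Submodule.span ℝ (Set.range b) := Submodule.subset_span ⟨i, rfl⟩
  have hspan : Submodule.span ℝ (Set.range β.M₂.col) ≤ Submodule.span ℝ (Set.range b) := by
    rw [Submodule.span_le, Set.range_subset_iff]
    have hYX : β.M₂.col 5 = -b 4 := (neg_eq_of_add_eq_zero_right hβ.anticomm).symm
    have hYY : β.M₂.col 6 = b 0 + b 3 := sub_eq_iff_eq_add.1 hβ.sq_sub_sq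
    intro i
    fin_cases i
    exacts [hb 0, hb 1, hb 2, hb 3, hb 4, hYX ▸ Submodule.neg_mem _ (hb 4),
      hYY ▸ Submodule.add_mem _ (hb 0) (hb 3)]
  rw [linearIndependent_iff_card_le_finrank_span, Fintype.card_fin]
  rw [rank_eq_finrank_span_cols] at hrank
  exact hrank.ge.trans (Submodule.finrank_mono hspan)

section PosSemidef

variable {β : TracialSeq} (hβ : β.ColumnRelations) (hrank : β.M₂.rank = 5)
  (hM : β.M₂.PosSemidef)
include hβ hrank hM

theorem ColumnRelations.posDef_M₂_leading :
    (β.M₂.submatrix (Fin.castLE (n := 5) (by decide)) (Fin.castLE (by decide))).PosDef :=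
  posDef_submatrix_of_linearIndependent_col hM _ (hβ.linearIndependent_col hrank)

theorem ColumnRelations.moment_XX_pos : 0 < β.moment [X, X] :=
  (hβ.posDef_M₂_leading hrank hM).diag_pos (i := 1)

theorem ColumnRelations.sq_moment_XX_lt (hnorm : β.Normalized) :
    β.moment [X, X] ^ 2 < β.moment [X, X, X, X] := by
  have hminor : 0 < det !![β.moment [], β.moment [X, X]; β.moment [X, X],
      β.moment [X, X, X, X]] := by
    have hpos := ((hβ.posDef_M₂_leading hrank hM).submatrix (e := ![0, 3]) (by decide)).det_pos
    rwa [eta_fin_two (submatrix _ _ _)] at hpos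
  rw [det_fin_two_of, show β.moment [] = 1 from hnorm] at hminor
  linarith

end PosSemidef

end TracialSeq

/-! ### Pairs of matrices on the hyperbola -/

theorem trace_mul_mul_eq_zero_of_anticomm {R n : Type*} [CommRing R] [NoZeroDivisors R] [CharZero R]
    [Fintype n] {A C M : Matrix n n R} (hAC : A * C = -(C * A)) (hAM : Commute A M) :
    (C * M * A).trace = 0 := by
  have h : (C * M * A).trace = -(C * M * A).trace := calc
    (C * M * A).trace = (A * C * M).trace := by rw [trace_mul_comm, mul_assoc]
    _ = -(C * M * A).trace := by rw [hAC, neg_mul, trace_neg, mul_assoc, hAM.eq, ← mul_assoc]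
  exact self_eq_neg.1 h

/-- Real symmetric matrices satisfying `XY + YX = 0` and `Y² - X² = 1`, that is, a pair on the
noncommutative hyperbola. -/
structure HyperbolicPair {n : Type*} [Fintype n] [DecidableEq n] (A B : Matrix n n ℝ) :
    Prop where
  symmA : A.IsSymm
  symmB : B.IsSymm
  anticomm : A * B = -(B * A)
  sq_eq : B * B = 1 + A * A

namespace HyperbolicPair

variable {n : Type*} [Fintype n] [DecidableEq n] {A B : Matrix n n ℝ}

theorem isUnit_det (h : HyperbolicPair A B) : IsUnit B.det := by
  have hpos : (B * B).PosDef := by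
    rw [h.sq_eq]
    nth_rewrite 1 [← h.symmA.eq]
    exact PosDef.one.add_posSemidef (posSemidef_conjTranspose_mul_self A)
  exact (isUnit_iff_isUnit_det B).1 (isUnit_mul_self_iff.1 hpos.isUnit)

theorem inv_anticomm (h : HyperbolicPair A B) : A * B⁻¹ = -(B⁻¹ * A) := calc
  A * B⁻¹ = B⁻¹ * (B * A) * B⁻¹ := by rw [nonsing_inv_mul_cancel_left _ _ h.isUnit_det]
  _ = -(B⁻¹ * A) := by
    rw [← neg_eq_iff_eq_neg.2 h.anticomm, mul_neg, neg_mul, ← mul_assoc,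
      mul_nonsing_inv_cancel_right _ _ h.isUnit_det]

theorem trace_A (h : HyperbolicPair A B) : A.trace = 0 := by
  have hBA : B * A = -(A * B) := by rw [h.anticomm, neg_neg]
  have hcomm : Commute B B⁻¹ := by
    rw [commute_iff_eq, mul_nonsing_inv _ h.isUnit_det, nonsing_inv_mul _ h.isUnit_det]
  simpa only [nonsing_inv_mul_cancel_right _ _ h.isUnit_det] using
    trace_mul_mul_eq_zero_of_anticomm hBA hcomm

theorem trace_inv_mul_mul (h : HyperbolicPair A B) {M : Matrix n n ℝ} (hM : Commute A M) :
    (B⁻¹ * M * A).trace = 0 :=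
  trace_mul_mul_eq_zero_of_anticomm h.inv_anticomm hM

theorem trace_inv (h : HyperbolicPair A B) : B⁻¹.trace = B.trace := calc
  B⁻¹.trace = (B⁻¹ + B⁻¹ * A * A).trace := by
    rw [trace_add, h.trace_inv_mul_mul (Commute.refl A), add_zero]
  _ = (B⁻¹ * (B * B)).trace := by rw [h.sq_eq, mul_add, mul_one, mul_assoc]
  _ = B.trace := by rw [nonsing_inv_mul_cancel_left _ _ h.isUnit_det]

theorem posSemidef_one_add_smul_inv (h : HyperbolicPair A B) {ε : ℝ} (hε : ε * ε = 1) :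
    (1 + ε • B⁻¹).PosSemidef := by
  set C := B⁻¹ with hC
  have hCsymm : Cᵀ = C := by rw [hC, transpose_nonsing_inv, h.symmB.eq]
  have hCsq : C * A * (A * C) = 1 - C * C := calc
    C * A * (A * C) = C * (B * B - 1) * C := by rw [h.sq_eq, add_sub_cancel_left]; noncomm_ring
    _ = C * B * (B * C) - C * C := by noncomm_ring
    _ = 1 - C * C := by
      rw [nonsing_inv_mul _ h.isUnit_det, mul_nonsing_inv _ h.isUnit_det, mul_one]
  have hsum : (1 + ε • C)ᴴ * (1 + ε • C) + (A * C)ᴴ * (A * C) = (2 : ℝ) • (1 + ε • C) := by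
    rw [conjTranspose_eq_transpose_of_trivial, conjTranspose_eq_transpose_of_trivial,
      transpose_mul, transpose_add, transpose_one, transpose_smul, hCsymm, h.symmA.eq, hCsq]
    have hexpand : (1 + ε • C) * (1 + ε • C) = 1 + (2 * ε) • C + (ε * ε) • (C * C) := by
      simp only [add_mul, mul_add, one_mul, mul_one, smul_mul_smul_comm]
      module
    rw [hexpand, hε]
    module
  have hpos : ((2 : ℝ) • (1 + ε • C)).PosSemidef :=
    hsum ▸ (posSemidef_conjTranspose_mul_self _).add (posSemidef_conjTranspose_mul_self _)
  simpa using hpos.smul (a := (2⁻¹ : ℝ)) (by norm_num)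

theorem abs_trace_le (h : HyperbolicPair A B) (s : ℝ) :
    |B.trace| ≤ Fintype.card n - 2 * s * (A * A).trace + s ^ 2 * (A * A * A * A).trace := by
  set D := 1 - s • (A * A) with hD
  have hDsymm : Dᴴ = D := by
    simp only [hD, conjTranspose_eq_transpose_of_trivial, transpose_sub, transpose_one,
      transpose_smul, transpose_mul, h.symmA.eq]
  have hDsq : D * D = 1 - (2 * s) • (A * A) + s ^ 2 • (A * A * A * A) := by
    simp only [hD, sub_mul, mul_sub, one_mul, mul_one, smul_mul_smul_comm, ← mul_assoc]
    module
  have htr : (B⁻¹ * (D * D)).trace = B.trace := by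
    have h2 : (B⁻¹ * A * A).trace = 0 := h.trace_inv_mul_mul (.refl A)
    have h4 : (B⁻¹ * (A * A * A) * A).trace = 0 :=
      h.trace_inv_mul_mul (((Commute.refl A).mul_right (.refl A)).mul_right (.refl A))
    rw [hDsq, mul_add, mul_sub, mul_one, mul_smul_comm, mul_smul_comm, trace_add, trace_sub,
      trace_smul, trace_smul, ← mul_assoc, h2, ← mul_assoc, h4, h.trace_inv, smul_zero, smul_zero,
      sub_zero, add_zero]
  have hε (ε : ℝ) (hε : ε * ε = 1) : 0 ≤ (D * D).trace + ε * B.trace := by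
    have hnonneg := ((h.posSemidef_one_add_smul_inv hε).conjTranspose_mul_mul_same D).trace_nonneg
    rwa [hDsymm, trace_mul_comm, ← mul_assoc, mul_add, mul_one, mul_smul_comm, trace_add,
      trace_smul, trace_mul_comm _ B⁻¹, htr, smul_eq_mul] at hnonneg
  have hDtr : (D * D).trace =
      Fintype.card n - 2 * s * (A * A).trace + s ^ 2 * (A * A * A * A).trace := by
    rw [hDsq, trace_add, trace_sub, trace_one, trace_smul, trace_smul, smul_eq_mul, smul_eq_mul]
  rw [← hDtr, abs_le]
  constructor <;> linarith [hε 1 (by norm_num), hε (-1) (by norm_num)]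

end HyperbolicPair

/-! ### Moments of atomic measures -/

theorem TracialSeq.isSymm_M₂ (β : TracialSeq) : β.M₂.IsSymm := by
  ext i j
  refine β.star _ _ ?_
  simp only [List.reverse_append, List.reverse_reverse]

namespace Atom

variable (a : Atom)

theorem eval_append (v w : List Letter) : a.eval (v ++ w) = a.eval v * a.eval w := by
  rw [eval, List.map_append, List.prod_append, eval, eval]

theorem eval_singleton_isSymm (l : Letter) : (a.eval [l]).IsSymm := by
  cases l
  · simpa only [eval, List.map_cons, List.map_nil, List.prod_singleton] using a.symmA
  · simpa only [eval, List.map_cons, List.map_nil, List.prod_singleton] using a.symmB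

theorem eval_reverse (w : List Letter) : a.eval w.reverse = (a.eval w)ᵀ := by
  induction w with
  | nil => exact transpose_one.symm
  | cons l w ih =>
    rw [List.reverse_cons, eval_append, ih, ← List.singleton_append (l := w), eval_append,
      transpose_mul, (a.eval_singleton_isSymm l).eq]

theorem trace_eq_of_isRotated {v w : List Letter} (h : v ~r w) : a.trace v = a.trace w := by
  obtain ⟨k, hk, rfl⟩ := List.isRotated_iff_mod.1 h
  rw [trace, trace, List.rotate_eq_drop_append_take hk, eval_append, trace_mul_comm,
    ← eval_append, List.take_append_drop]

theorem trace_reverse (w : List Letter) : a.trace w.reverse = a.trace w := by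
  rw [trace, trace, eval_reverse, trace_transpose]

/-- The evaluation `p ↦ p(A, B)` of noncommutative polynomials of degree at most two, given by
their coefficients in the basis `basisWord`. -/
noncomputable def evalPoly : (Fin 7 → ℝ) →ₗ[ℝ] Matrix (Fin a.size) (Fin a.size) ℝ :=
  Fintype.linearCombination ℝ fun j => a.eval (basisWord j).1

theorem evalPoly_single (j : Fin 7) : a.evalPoly (Pi.single j 1) = a.eval (basisWord j).1 := by
  rw [evalPoly, Fintype.linearCombination_apply_single, one_smul]

theorem hyperbolicPair_iff : HyperbolicPair a.A a.B ↔
    a.evalPoly (Pi.single 4 1 + Pi.single 5 1) = 0 ∧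
      a.evalPoly (Pi.single 6 1 - Pi.single 3 1 - Pi.single 0 1) = 0 := by
  have hXY : a.eval [X, Y] = a.A * a.B := by simp [eval]
  have hYX : a.eval [Y, X] = a.B * a.A := by simp [eval]
  have hXX : a.eval [X, X] = a.A * a.A := by simp [eval]
  have hYY : a.eval [Y, Y] = a.B * a.B := by simp [eval]
  have h1 : a.eval [] = 1 := rfl
  have hanticomm : a.evalPoly (Pi.single 4 1 + Pi.single 5 1) = a.A * a.B + a.B * a.A := by
    rw [map_add, evalPoly_single, evalPoly_single, ← hXY, ← hYX]
    rfl
  have hsq : a.evalPoly (Pi.single 6 1 - Pi.single 3 1 - Pi.single 0 1) =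
      a.B * a.B - a.A * a.A - 1 := by
    rw [map_sub, map_sub, evalPoly_single, evalPoly_single, evalPoly_single, ← hXX, ← hYY, ← h1]
    rfl
  rw [hanticomm, hsq, add_eq_zero_iff_eq_neg, sub_sub, sub_eq_zero, add_comm (a.A * a.A)]
  exact ⟨fun h => ⟨h.anticomm, h.sq_eq⟩, fun h => ⟨a.symmA, a.symmB, h.1, h.2⟩⟩

end Atom

namespace AtomicMeasure

variable (μ : AtomicMeasure)

/-- The moments of a finitely atomic measure. -/
noncomputable def momentSeq : TracialSeq where
  toFun w := ∑ i, μ.density i * (μ.atom i).trace w.1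
  cyclic v w h := Finset.sum_congr rfl fun i _ => by rw [(μ.atom i).trace_eq_of_isRotated h]
  star v w h := Finset.sum_congr rfl fun i _ => by rw [h, (μ.atom i).trace_reverse]

theorem represents_iff_momentSeq_eq {μ : AtomicMeasure} {β : TracialSeq} :
    μ.Represents β ↔ μ.momentSeq = β := by
  constructor
  · intro h
    cases β
    unfold momentSeq
    congr 1
    exact funext fun w => (h w).symm
  · rintro rfl w
    rfl

theorem M₂_momentSeq_apply (j k : Fin 7) :
    μ.momentSeq.M₂ j k = ∑ i, μ.density i / (μ.atom i).size *
      (((μ.atom i).eval (basisWord j).1)ᴴ * (μ.atom i).eval (basisWord k).1).trace := by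
  change ∑ i, μ.density i * (μ.atom i).trace ((basisWord j).1.reverse ++ (basisWord k).1) = _
  refine Fintype.sum_congr _ _ fun i => ?_
  rw [Atom.trace, Atom.eval_append, Atom.eval_reverse, conjTranspose_eq_transpose_of_trivial,
    mul_div_assoc', div_mul_eq_mul_div]

theorem dotProduct_M₂_mulVec (p q : Fin 7 → ℝ) :
    p ⬝ᵥ μ.momentSeq.M₂ *ᵥ q = ∑ i, μ.density i / (μ.atom i).size *
      (((μ.atom i).evalPoly p)ᴴ * (μ.atom i).evalPoly q).trace := by
  simp only [dotProduct, mulVec, M₂_momentSeq_apply, Atom.evalPoly,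
    Fintype.linearCombination_apply, conjTranspose_sum, conjTranspose_smul, star_trivial,
    Finset.sum_mul, Finset.mul_sum, smul_mul_smul_comm, trace_sum, trace_smul, smul_eq_mul]
  rw [Finset.sum_comm_cycle]
  refine Fintype.sum_congr _ _ fun i => ?_
  rw [Finset.sum_comm]
  exact Fintype.sum_congr _ _ fun k => Fintype.sum_congr _ _ fun j => by ring

theorem posSemidef_M₂ : μ.momentSeq.M₂.PosSemidef := by
  refine .of_dotProduct_mulVec_nonneg μ.momentSeq.isSymm_M₂ fun p => ?_
  rw [star_trivial, dotProduct_M₂_mulVec]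
  exact Finset.sum_nonneg fun i _ => mul_nonneg
    (div_nonneg (μ.density_pos i).le (Nat.cast_nonneg _))
    (posSemidef_conjTranspose_mul_self _).trace_nonneg

theorem M₂_mulVec_eq_zero_iff (p : Fin 7 → ℝ) :
    μ.momentSeq.M₂ *ᵥ p = 0 ↔ ∀ i, (μ.atom i).evalPoly p = 0 := by
  constructor
  · intro h i
    have hweight (i) : 0 < μ.density i / (μ.atom i).size :=
      div_pos (μ.density_pos i) (Nat.cast_pos.2 (μ.atom i).size_pos)
    have hsum := μ.dotProduct_M₂_mulVec p p
    rw [h, dotProduct_zero, eq_comm, Finset.sum_eq_zero_iff_of_nonneg fun i _ =>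
      mul_nonneg (hweight i).le (posSemidef_conjTranspose_mul_self _).trace_nonneg] at hsum
    have htrace := (mul_eq_zero.1 (hsum i (Finset.mem_univ i))).resolve_left (hweight i).ne'
    exact trace_conjTranspose_mul_self_eq_zero_iff.1 htrace
  · intro h
    refine dotProduct_eq_zero _ fun q => ?_
    rw [dotProduct_comm, dotProduct_M₂_mulVec]
    exact Finset.sum_eq_zero fun i _ => by rw [h, mul_zero, trace_zero, mul_zero]

end AtomicMeasure

theorem TracialSeq.columnRelations_iff_mulVec_eq_zero (β : TracialSeq) :
    β.ColumnRelations ↔ β.M₂ *ᵥ (Pi.single 4 1 + Pi.single 5 1) = 0 ∧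
      β.M₂ *ᵥ (Pi.single 6 1 - Pi.single 3 1 - Pi.single 0 1) = 0 := by
  simp only [mulVec_add, mulVec_sub, mulVec_single_one, sub_eq_zero]
  exact ⟨fun h => ⟨h.1, h.2⟩, fun h => ⟨h.1, h.2⟩⟩

theorem AtomicMeasure.columnRelations_momentSeq_iff (μ : AtomicMeasure) :
    μ.momentSeq.ColumnRelations ↔ ∀ i, HyperbolicPair (μ.atom i).A (μ.atom i).B := by
  rw [TracialSeq.columnRelations_iff_mulVec_eq_zero, M₂_mulVec_eq_zero_iff, M₂_mulVec_eq_zero_iff,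
    ← forall_and]
  refine forall_congr' fun i => ?_
  rw [(μ.atom i).hyperbolicPair_iff]

namespace Atom

theorem trace_nil (a : Atom) : a.trace [] = 1 := by
  rw [trace, show a.eval [] = 1 from rfl, trace_one, Fintype.card_fin,
    div_self (Nat.cast_ne_zero.2 a.size_pos.ne')]

theorem trace_X (a : Atom) : a.trace [X] = a.A.trace / a.size := by
  simp [trace, eval]

theorem trace_Y (a : Atom) : a.trace [Y] = a.B.trace / a.size := by
  simp [trace, eval]

theorem trace_XX (a : Atom) : a.trace [X, X] = (a.A * a.A).trace / a.size := by
  simp [trace, eval]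

theorem trace_XXXX (a : Atom) : a.trace [X, X, X, X] = (a.A * a.A * a.A * a.A).trace / a.size := by
  simp [trace, eval, mul_assoc]

theorem trace_X_eq_zero {a : Atom} (h : HyperbolicPair a.A a.B) : a.trace [X] = 0 := by
  rw [trace_X, h.trace_A, zero_div]

theorem abs_trace_Y_le {a : Atom} (h : HyperbolicPair a.A a.B) (s : ℝ) :
    |a.trace [Y]| ≤ 1 - 2 * s * a.trace [X, X] + s ^ 2 * a.trace [X, X, X, X] := by
  have hsize : (0 : ℝ) < a.size := Nat.cast_pos.2 a.size_pos
  calc |a.trace [Y]| = |a.B.trace| / a.size := by rw [trace_Y, abs_div, abs_of_pos hsize]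
    _ ≤ (a.size - 2 * s * (a.A * a.A).trace + s ^ 2 * (a.A * a.A * a.A * a.A).trace) / a.size := by
      gcongr
      simpa only [Fintype.card_fin] using h.abs_trace_le s
    _ = _ := by
      rw [trace_XX, trace_XXXX]
      field_simp

end Atom

namespace AtomicMeasure

theorem normalized_momentSeq (μ : AtomicMeasure) : μ.momentSeq.Normalized := by
  change ∑ i, μ.density i * (μ.atom i).trace [] = 1
  simp only [Atom.trace_nil, mul_one, μ.density_sum]

variable {μ : AtomicMeasure} (hμ : ∀ i, HyperbolicPair (μ.atom i).A (μ.atom i).B)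
include hμ

theorem moment_X_eq_zero : μ.momentSeq.moment [X] = 0 := by
  change ∑ i, μ.density i * (μ.atom i).trace [X] = 0
  exact Finset.sum_eq_zero fun i _ => by rw [Atom.trace_X_eq_zero (hμ i), mul_zero]

theorem abs_moment_Y_le (s : ℝ) :
    |μ.momentSeq.moment [Y]| ≤
      1 - 2 * s * μ.momentSeq.moment [X, X] + s ^ 2 * μ.momentSeq.moment [X, X, X, X] := calc
  |∑ i, μ.density i * (μ.atom i).trace [Y]| ≤ ∑ i, |μ.density i * (μ.atom i).trace [Y]| :=
    Finset.abs_sum_le_sum_abs _ _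
  _ ≤ ∑ i, μ.density i *
      (1 - 2 * s * (μ.atom i).trace [X, X] + s ^ 2 * (μ.atom i).trace [X, X, X, X]) := by
    refine Finset.sum_le_sum fun i _ => ?_
    rw [abs_mul, abs_of_pos (μ.density_pos i)]
    exact mul_le_mul_of_nonneg_left (Atom.abs_trace_Y_le (hμ i) s) (μ.density_pos i).le
  _ = 1 - 2 * s * (∑ i, μ.density i * (μ.atom i).trace [X, X]) +
      s ^ 2 * ∑ i, μ.density i * (μ.atom i).trace [X, X, X, X] := by
    simp only [mul_add, mul_sub, mul_one, Finset.sum_add_distrib, Finset.sum_sub_distrib,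
      μ.density_sum, Finset.mul_sum, mul_left_comm]

theorem sq_moment_XX_le : μ.momentSeq.moment [X, X] ^ 2 ≤
    μ.momentSeq.moment [X, X, X, X] * (1 - |μ.momentSeq.moment [Y]|) := by
  set β := μ.momentSeq
  have hquad (s : ℝ) : 0 ≤ β.moment [X, X, X, X] * (s * s) + -2 * β.moment [X, X] * s +
      (1 - |β.moment [Y]|) := by
    linarith [abs_moment_Y_le hμ s]
  have hdiscrim := discrim_le_zero hquad
  rw [discrim] at hdiscrim
  linarith

end AtomicMeasure

theorem exists_unit_eigenvector {n : Type*} [Fintype n] {A : Matrix n n ℝ}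
    (hA : A.IsSymm) (hA0 : A ≠ 0) :
    ∃ α : ℝ, α ≠ 0 ∧ ∃ v : n → ℝ, v ⬝ᵥ v = 1 ∧ A *ᵥ v = α • v := by
  classical
  have hH : A.IsHermitian := hA
  obtain ⟨i, hi⟩ := Function.ne_iff.1 (hH.eigenvalues_eq_zero_iff.not.2 hA0)
  refine ⟨hH.eigenvalues i, hi, hH.eigenvectorBasis i, ?_, hH.mulVec_eigenvectorBasis i⟩
  rw [← one_pow 2, ← hH.eigenvectorBasis.norm_eq_one i, EuclideanSpace.real_norm_sq_eq]
  simp only [dotProduct, sq]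

namespace HyperbolicPair

variable {n : Type*} [Fintype n] {A B : Matrix n n ℝ}

/-- An eigenvector `v` of `A` with eigenvalue `α`, together with a normalization `w` of `B v`: in
the orthonormal family `v, w` the pair acts as `diag(α, -α)` and `√(1 + α²)` times the swap. -/
structure Ladder (A B : Matrix n n ℝ) (α : ℝ) (v w : n → ℝ) : Prop where
  dotProduct_self_left : v ⬝ᵥ v = 1
  dotProduct_self_right : w ⬝ᵥ w = 1
  dotProduct_eq_zero : v ⬝ᵥ w = 0
  A_left : A *ᵥ v = α • v
  A_right : A *ᵥ w = (-α) • w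
  B_left : B *ᵥ v = √(1 + α ^ 2) • w
  B_right : B *ᵥ w = √(1 + α ^ 2) • v

theorem Ladder.symm {α : ℝ} {v w : n → ℝ} (h : Ladder A B α v w) : Ladder A B (-α) w v where
  dotProduct_self_left := h.dotProduct_self_right
  dotProduct_self_right := h.dotProduct_self_left
  dotProduct_eq_zero := by rw [dotProduct_comm, h.dotProduct_eq_zero]
  A_left := h.A_right
  A_right := by rw [neg_neg, h.A_left]
  B_left := by rw [neg_sq, h.B_right]
  B_right := by rw [neg_sq, h.B_left]

variable [DecidableEq n]

theorem exists_ladder_of_eigenvector (h : HyperbolicPair A B) {α : ℝ} {v : n → ℝ} (hα : α ≠ 0)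
    (hv : v ⬝ᵥ v = 1) (hAv : A *ᵥ v = α • v) : ∃ w, Ladder A B α v w := by
  set r := √(1 + α ^ 2)
  have hr0 : r ≠ 0 := by positivity
  have hrsq : r * r = 1 + α ^ 2 := Real.mul_self_sqrt (by positivity)
  have hBBv : B *ᵥ B *ᵥ v = (r * r) • v := by
    rw [mulVec_mulVec, h.sq_eq, add_mulVec, one_mulVec, ← mulVec_mulVec, hAv, mulVec_smul, hAv,
      hrsq]
    module
  have hBvBv : B *ᵥ v ⬝ᵥ B *ᵥ v = r * r := by
    rw [dotProduct_mulVec, ← mulVec_transpose, h.symmB.eq, hBBv, smul_dotProduct, hv, smul_eq_mul,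
      mul_one]
  have hAw : A *ᵥ (r⁻¹ • B *ᵥ v) = (-α) • r⁻¹ • B *ᵥ v := by
    rw [mulVec_smul, mulVec_mulVec, h.anticomm, neg_mulVec, ← mulVec_mulVec, hAv, mulVec_smul]
    module
  refine ⟨r⁻¹ • B *ᵥ v, hv, ?_, ?_, hAv, hAw, ?_, ?_⟩
  · rw [smul_dotProduct, dotProduct_smul, hBvBv, smul_eq_mul, smul_eq_mul]
    field_simp
  · set w := r⁻¹ • B *ᵥ v
    have hvw : α * (v ⬝ᵥ w) = -α * (v ⬝ᵥ w) := calc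
      α * (v ⬝ᵥ w) = A *ᵥ v ⬝ᵥ w := by rw [hAv, smul_dotProduct, smul_eq_mul]
      _ = v ⬝ᵥ A *ᵥ w := by rw [dotProduct_mulVec, ← mulVec_transpose, h.symmA.eq]
      _ = -α * (v ⬝ᵥ w) := by rw [hAw, dotProduct_smul, smul_eq_mul]
    rw [neg_mul, self_eq_neg, mul_eq_zero] at hvw
    exact hvw.resolve_left hα
  · rw [smul_inv_smul₀ hr0]
  · rw [mulVec_smul, hBBv, smul_smul, inv_mul_cancel_left₀ hr0]

theorem exists_ladder (h : HyperbolicPair A B) (hA : A ≠ 0) :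
    ∃ α > 0, ∃ v w, Ladder A B α v w := by
  obtain ⟨α, hα, v, hv, hAv⟩ := exists_unit_eigenvector h.symmA hA
  obtain ⟨w, hw⟩ := h.exists_ladder_of_eigenvector hα hv hAv
  rcases hα.lt_or_gt with hneg | hpos
  · exact ⟨-α, neg_pos.2 hneg, w, v, hw.symm⟩
  · exact ⟨α, hpos, v, w, hw⟩

end HyperbolicPair

/-! ### The irreducible atoms of size at most two -/

theorem hyperbolicPair_point {b : ℝ} (hb : b * b = 1) :
    HyperbolicPair (0 : Matrix (Fin 1) (Fin 1) ℝ) !![b] where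
  symmA := transpose_zero
  symmB := .ext fun i j => by rw [Subsingleton.elim i j]
  anticomm := by rw [zero_mul, mul_zero, neg_zero]
  sq_eq := by
    ext i j
    simp [Subsingleton.elim i 0, Subsingleton.elim j 0, hb]

theorem hyperbolicPair_plane (α : ℝ) :
    HyperbolicPair !![α, 0; 0, -α] !![0, √(1 + α ^ 2); √(1 + α ^ 2), 0] where
  symmA := .ext <| by simp [Fin.forall_fin_two]
  symmB := .ext <| by simp [Fin.forall_fin_two]
  anticomm := by simp [mul_comm]
  sq_eq := by
    have hsqrt : √(1 + α ^ 2) * √(1 + α ^ 2) = 1 + α * α := by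
      rw [Real.mul_self_sqrt (by positivity), sq]
    simp [one_fin_two, hsqrt]

/-- The atom of size one at the point `(0, b)`. -/
noncomputable def pointAtom (b : ℝ) : Atom where
  size := 1
  size_pos := one_pos
  A := 0
  B := !![b]
  symmA := transpose_zero
  symmB := .ext fun i j => by rw [Subsingleton.elim i j]

/-- The atom of size two with `A = diag(α, -α)` and `B` equal to `√(1 + α²)` times the swap. -/
noncomputable def planeAtom (α : ℝ) : Atom where
  size := 2
  size_pos := two_pos
  A := !![α, 0; 0, -α]
  B := !![0, √(1 + α ^ 2); √(1 + α ^ 2), 0]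
  symmA := (hyperbolicPair_plane α).symmA
  symmB := (hyperbolicPair_plane α).symmB

theorem trace_pointAtom_Y (b : ℝ) : (pointAtom b).trace [Y] = b := by
  rw [Atom.trace_Y]
  change trace !![b] / ((1 : ℕ) : ℝ) = b
  simp

theorem trace_pointAtom_XX (b : ℝ) : (pointAtom b).trace [X, X] = 0 := by
  rw [Atom.trace_XX, show (pointAtom b).A = 0 from rfl, mul_zero, trace_zero, zero_div]

theorem trace_pointAtom_XXXX (b : ℝ) : (pointAtom b).trace [X, X, X, X] = 0 := by
  rw [Atom.trace_XXXX, show (pointAtom b).A = 0 from rfl, mul_zero, trace_zero, zero_div]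

theorem trace_planeAtom_Y (α : ℝ) : (planeAtom α).trace [Y] = 0 := by
  rw [Atom.trace_Y]
  change trace !![0, √(1 + α ^ 2); √(1 + α ^ 2), 0] / _ = _
  rw [trace_fin_two_of, add_zero, zero_div]

theorem trace_planeAtom_XX (α : ℝ) : (planeAtom α).trace [X, X] = α ^ 2 := by
  rw [Atom.trace_XX]
  change trace (!![α, 0; 0, -α] * !![α, 0; 0, -α]) / ((2 : ℕ) : ℝ) = _
  simp [trace_fin_two, sq]

theorem trace_planeAtom_XXXX (α : ℝ) : (planeAtom α).trace [X, X, X, X] = α ^ 4 := by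
  rw [Atom.trace_XXXX]
  change trace (!![α, 0; 0, -α] * !![α, 0; 0, -α] * !![α, 0; 0, -α] * !![α, 0; 0, -α]) /
    ((2 : ℕ) : ℝ) = _
  simp [trace_fin_two, pow_succ]

namespace Atom

theorem OrthEquiv.refl (a : Atom) : a.OrthEquiv a :=
  ⟨1, by simp, by simp, by simp, by simp⟩

theorem OrthEquiv.size_eq {a b : Atom} : a.OrthEquiv b → a.size = b.size := by
  rintro ⟨U, hU, hU', -⟩
  have htrace := congrArg Matrix.trace hU
  rw [trace_mul_comm, hU', trace_one, trace_one, Fintype.card_fin, Fintype.card_fin] at htrace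
  exact_mod_cast htrace

theorem OrthEquiv.exists_eval_eq {a b : Atom} : a.OrthEquiv b →
    ∃ U : Matrix (Fin b.size) (Fin a.size) ℝ, Uᵀ * U = 1 ∧ ∀ w, b.eval w = U * a.eval w * Uᵀ := by
  rintro ⟨U, hU, hU', hA, hB⟩
  have hsingleton (l : Letter) : b.eval [l] = U * a.eval [l] * Uᵀ := by
    cases l
    · simpa [eval] using hA
    · simpa [eval] using hB
  refine ⟨U, hU', fun w => ?_⟩
  induction w with
  | nil => simp [eval, hU]
  | cons l w ih =>
    rw [← List.singleton_append, eval_append, eval_append, hsingleton, ih]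
    calc U * a.eval [l] * Uᵀ * (U * a.eval w * Uᵀ)
        = U * a.eval [l] * (Uᵀ * U) * (a.eval w * Uᵀ) := by simp only [Matrix.mul_assoc]
      _ = U * (a.eval [l] * a.eval w) * Uᵀ := by
        rw [hU', Matrix.mul_one]
        simp only [Matrix.mul_assoc]

theorem OrthEquiv.trace_eq {a b : Atom} (h : a.OrthEquiv b) (w : List Letter) :
    a.trace w = b.trace w := by
  obtain ⟨U, hU, heval⟩ := h.exists_eval_eq
  have hsize : (a.size : ℝ) = b.size := congrArg Nat.cast h.size_eq
  rw [trace, trace, heval, trace_mul_comm, ← Matrix.mul_assoc, hU, Matrix.one_mul, hsize]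

theorem A_eq_zero_of_size_eq_one {a : Atom} (h : HyperbolicPair a.A a.B) (hs : a.size = 1) :
    a.A = 0 := by
  obtain ⟨n, hn, A, B, hA, hB⟩ := a
  obtain rfl : n = 1 := hs
  have htrace : A.trace = 0 := h.trace_A
  ext i j
  simpa [Subsingleton.elim i 0, Subsingleton.elim j 0, Matrix.trace] using htrace

theorem pointAtom_orthEquiv_of_size_eq_one {a : Atom} (h : HyperbolicPair a.A a.B)
    (hs : a.size = 1) : (pointAtom 1).OrthEquiv a ∨ (pointAtom (-1)).OrthEquiv a := by
  have hA0 := A_eq_zero_of_size_eq_one h hs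
  obtain ⟨n, hn, A, B, hA, hB⟩ := a
  obtain rfl : n = 1 := hs
  obtain rfl : A = 0 := hA0
  have hB (b : ℝ) (hb : B 0 0 = b) : B = !![b] := by
    ext i j
    simp [Subsingleton.elim i 0, Subsingleton.elim j 0, hb]
  have hsq : B 0 0 * B 0 0 = 1 := by
    simpa [mul_apply] using congrFun₂ (h.sq_eq : B * B = 1 + 0 * 0) 0 0
  rcases mul_self_eq_one_iff.1 hsq with h1 | h1
  · obtain rfl := hB 1 h1
    exact .inl (OrthEquiv.refl (pointAtom 1))
  · obtain rfl := hB (-1) h1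
    exact .inr (OrthEquiv.refl (pointAtom (-1)))

theorem exists_planeAtom_orthEquiv {a : Atom} (h : HyperbolicPair a.A a.B) (hs : a.size = 2)
    (hA : a.A ≠ 0) : ∃ α > 0, (planeAtom α).OrthEquiv a := by
  obtain ⟨n, hn, A, B, hsA, hsB⟩ := a
  obtain rfl : n = 2 := hs
  obtain ⟨α, hα, v, w, hvw⟩ := h.exists_ladder hA
  let U : Matrix (Fin 2) (Fin 2) ℝ := of fun i j => ![v i, w i] j
  have hU : Uᵀ * U = 1 := by
    ext i j
    have hwv : w ⬝ᵥ v = 0 := by rw [dotProduct_comm, hvw.dotProduct_eq_zero]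
    fin_cases i <;> fin_cases j
    exacts [hvw.dotProduct_self_left, hvw.dotProduct_eq_zero, hwv, hvw.dotProduct_self_right]
  have hU' : U * Uᵀ = 1 := mul_eq_one_comm.1 hU
  have hcol (C : Matrix (Fin 2) (Fin 2) ℝ) (i j) : (C * U) i j = ![(C *ᵥ v) i, (C *ᵥ w) i] j := by
    fin_cases j <;> rfl
  have hAU : A * U = U * !![α, 0; 0, -α] := by
    ext i j
    rw [hcol, hvw.A_left, hvw.A_right]
    fin_cases j <;> simp [U, mul_apply, mul_comm]
  have hBU : B * U = U * !![0, √(1 + α ^ 2); √(1 + α ^ 2), 0] := by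
    ext i j
    rw [hcol, hvw.B_left, hvw.B_right]
    fin_cases j <;> simp [U, mul_apply, mul_comm]
  refine ⟨α, hα, U, hU', hU, ?_, ?_⟩
  · change A = U * !![α, 0; 0, -α] * Uᵀ
    rw [← hAU, Matrix.mul_assoc, hU', Matrix.mul_one]
  · change B = U * !![0, √(1 + α ^ 2); √(1 + α ^ 2), 0] * Uᵀ
    rw [← hBU, Matrix.mul_assoc, hU', Matrix.mul_one]

end Atom

/-! ### Combinations of atoms and classes of equivalent atoms -/

section SupportIndex

variable {ι : Type*} [Fintype ι] (p : ι → ℝ)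

/-- An enumeration of the indices at which `p` does not vanish. -/
noncomputable def supportIndex (i : Fin (Fintype.card {j // p j ≠ 0})) : ι :=
  (Fintype.equivFin {j // p j ≠ 0}).symm i

variable {p}

theorem supportIndex_injective : Function.Injective (supportIndex p) :=
  Subtype.val_injective.comp (Equiv.injective _)

theorem apply_supportIndex_ne_zero (i) : p (supportIndex p i) ≠ 0 :=
  ((Fintype.equivFin {j // p j ≠ 0}).symm i).2

theorem exists_supportIndex_eq {j : ι} (hj : p j ≠ 0) : ∃ i, supportIndex p i = j :=
  ⟨Fintype.equivFin _ ⟨j, hj⟩, by rw [supportIndex, Equiv.symm_apply_apply]⟩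

theorem sum_mul_supportIndex (f : ι → ℝ) :
    ∑ i, p (supportIndex p i) * f (supportIndex p i) = ∑ j, p j * f j := by
  have hne (j : ι) (_ : j ∈ Finset.univ) : p j * f j ≠ 0 → p j ≠ 0 := left_ne_zero_of_mul
  rw [← Finset.sum_filter_of_ne hne, Finset.sum_subtype (p := fun j => p j ≠ 0) _ (by simp)]
  exact Equiv.sum_comp (Fintype.equivFin {j // p j ≠ 0}).symm fun j => p j * f j

end SupportIndex

namespace AtomicMeasure

variable {ι : Type*} [Fintype ι] (atom : ι → Atom) {p : ι → ℝ} (hp : p ∈ stdSimplex ℝ ι)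

/-- The convex combination of the atoms `atom j` with weights `p j`. The indices of weight zero
are discarded, because densities are positive. -/
noncomputable def ofWeights : AtomicMeasure where
  N := Fintype.card {j // p j ≠ 0}
  atom i := atom (supportIndex p i)
  density i := p (supportIndex p i)
  density_pos i := (hp.1 _).lt_of_ne' (apply_supportIndex_ne_zero i)
  density_sum := by simpa [hp.2] using sum_mul_supportIndex (p := p) 1

variable {atom}

theorem moment_ofWeights (w : List Letter) (h : w.length ≤ 4) :
    (ofWeights atom hp).momentSeq.moment w h = ∑ j, p j * (atom j).trace w :=
  sum_mul_supportIndex fun j => (atom j).trace w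

theorem mult_ofWeights (s : ℕ) : (ofWeights atom hp).mult s =
    (Finset.univ.filter fun j => p j ≠ 0 ∧ (atom j).size = s).card := by
  refine Finset.card_nbij (supportIndex p) (fun i hi => ?_) supportIndex_injective.injOn
    fun j hj => ?_
  · exact Finset.mem_filter.2 ⟨Finset.mem_univ _, apply_supportIndex_ne_zero i,
      (Finset.mem_filter.1 hi).2⟩
  · obtain ⟨hne, hsize⟩ := (Finset.mem_filter.1 (Finset.mem_coe.1 hj)).2
    obtain ⟨i, rfl⟩ := exists_supportIndex_eq hne
    exact ⟨i, Finset.mem_filter.2 ⟨Finset.mem_univ i, hsize⟩, rfl⟩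

variable [DecidableEq ι] {ν : AtomicMeasure} {κ : Fin ν.N → ι}

variable (ν κ) in
/-- The total density of the atoms of `ν` in the class `j`. -/
def classWeight (j : ι) : ℝ :=
  ∑ i with κ i = j, ν.density i

theorem moment_eq_sum_classWeight (hκ : ∀ i, (atom (κ i)).OrthEquiv (ν.atom i))
    (w : List Letter) (h : w.length ≤ 4) :
    ν.momentSeq.moment w h = ∑ j, ν.classWeight κ j * (atom j).trace w := calc
  ∑ i, ν.density i * (ν.atom i).trace w = ∑ i, ν.density i * (atom (κ i)).trace w :=
    Fintype.sum_congr _ _ fun i => by rw [(hκ i).trace_eq]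
  _ = ∑ j, ∑ i with κ i = j, ν.density i * (atom j).trace w := by
    rw [← Finset.sum_fiberwise Finset.univ κ]
    refine Fintype.sum_congr _ _ fun j => Finset.sum_congr rfl fun i hi => ?_
    rw [(Finset.mem_filter.1 hi).2]
  _ = ∑ j, ν.classWeight κ j * (atom j).trace w := by
    simp only [classWeight, Finset.sum_mul]

variable (hw : ν.classWeight κ = p)
include hw

theorem exists_injective_section : ∃ g : Fin (Fintype.card {j // p j ≠ 0}) → Fin ν.N,
    g.Injective ∧ ∀ i, κ (g i) = supportIndex p i := by
  have hex (i) : ∃ k, κ k = supportIndex p i := by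
    have hne : ν.classWeight κ (supportIndex p i) ≠ 0 := hw ▸ apply_supportIndex_ne_zero i
    obtain ⟨k, hk, -⟩ := Finset.exists_ne_zero_of_sum_ne_zero hne
    exact ⟨k, (Finset.mem_filter.1 hk).2⟩
  choose g hg using hex
  exact ⟨g, fun i k hik => supportIndex_injective (by rw [← hg, ← hg, hik]), hg⟩

theorem mult_ofWeights_le (hκ : ∀ i, (atom (κ i)).OrthEquiv (ν.atom i)) (s : ℕ) :
    (ofWeights atom hp).mult s ≤ ν.mult s := by
  obtain ⟨g, hinj, hg⟩ := exists_injective_section hw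
  have hsize (i) : (ν.atom (g i)).size = (atom (supportIndex p i)).size := by
    rw [← (hκ (g i)).size_eq, hg]
  refine Finset.card_le_card_of_injOn g (fun i hi => ?_) hinj.injOn
  exact Finset.mem_filter.2 ⟨Finset.mem_univ _, (hsize i).trans (Finset.mem_filter.1 hi).2⟩

theorem ofWeights_orthEquiv (hκ : ∀ i, (atom (κ i)).OrthEquiv (ν.atom i))
    (hN : (ofWeights atom hp).N = ν.N) : (ofWeights atom hp).OrthEquiv ν := by
  obtain ⟨g, hinj, hg⟩ := exists_injective_section hw
  have hbij : g.Bijective := (Fintype.bijective_iff_injective_and_card g).2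
    ⟨hinj, by rw [Fintype.card_fin, Fintype.card_fin]; exact hN⟩
  have hfiber (i) (k : Fin ν.N) : κ k = supportIndex p i ↔ k = g i := by
    obtain ⟨l, rfl⟩ := hbij.2 k
    rw [hg, supportIndex_injective.eq_iff, hinj.eq_iff]
  have hdensity (i) : ν.density (g i) = p (supportIndex p i) := by
    rw [← congrFun hw (supportIndex p i), classWeight]
    simp only [hfiber, Finset.filter_eq', Finset.mem_univ, if_true, Finset.sum_singleton]
  have hequiv (i) : (atom (supportIndex p i)).OrthEquiv (ν.atom (g i)) := hg i ▸ hκ (g i)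
  exact ⟨.ofBijective g hbij, fun i => ⟨hdensity i, hequiv i⟩⟩

end AtomicMeasure

/-! ### Minimality and types -/

theorem Atom.trace_XXYY_of_size_le_one {a : Atom} (h : a.size ≤ 1) :
    a.trace [X, X, Y, Y] = a.trace [X, Y, X, Y] := by
  have hsub : Subsingleton (Fin a.size) := Fin.subsingleton_iff_le_one.2 h
  have hcomm : a.A * a.B = a.B * a.A := by
    ext j k
    rw [Subsingleton.elim k j, mul_apply, mul_apply, Fintype.sum_subsingleton _ j,
      Fintype.sum_subsingleton _ j, mul_comm]
  have hXXYY : a.eval [X, X, Y, Y] = a.A * (a.A * a.B) * a.B := by simp [eval, mul_assoc]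
  have hXYXY : a.eval [X, Y, X, Y] = a.A * (a.B * a.A) * a.B := by simp [eval, mul_assoc]
  rw [trace, trace, hXXYY, hXYXY, hcomm]

namespace AtomicMeasure

variable {μ ν : AtomicMeasure} {β : TracialSeq}

theorem mult_maxSize_pos (μ : AtomicMeasure) : 0 < μ.mult μ.maxSize := by
  have hN : (Finset.univ : Finset (Fin μ.N)).Nonempty := by
    rw [Finset.nonempty_iff_ne_empty]
    intro h
    simpa [h] using μ.density_sum
  obtain ⟨i, -, hi⟩ := Finset.exists_mem_eq_sup _ hN fun i => (μ.atom i).size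
  exact Finset.card_pos.2 ⟨i, Finset.mem_filter.2 ⟨Finset.mem_univ i, hi.symm⟩⟩

theorem IsMinimal.maxSize_eq (hμ : μ.IsMinimal β) (hν : ν.IsMinimal β) :
    μ.maxSize = ν.maxSize :=
  le_antisymm (not_lt.1 fun h => hμ.2 ν hν.1 (.inl h)) (not_lt.1 fun h => hν.2 μ hμ.1 (.inl h))

theorem IsMinimal.mult_eq (hμ : μ.IsMinimal β) (hν : ν.IsMinimal β) {s : ℕ} (hs : 1 ≤ s)
    (hsr : s ≤ μ.maxSize) : μ.mult s = ν.mult s := by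
  have hmax := hμ.maxSize_eq hν
  induction hn : μ.maxSize - s using Nat.strong_induction_on generalizing s with
  | h n ih =>
    have habove (t : ℕ) (hst : s < t) (ht : t ≤ μ.maxSize) : μ.mult t = ν.mult t :=
      ih _ (by omega) (hs.trans hst.le) ht rfl
    refine le_antisymm (not_lt.1 fun h => hμ.2 ν hν.1 (.inr ?_))
      (not_lt.1 fun h => hν.2 μ hμ.1 (.inr ?_))
    · exact ⟨hmax.symm, s, hs, hsr, h, fun t hst ht => (habove t hst ht).symm⟩
    · exact ⟨hmax, s, hs, hmax ▸ hsr, h, fun t hst ht => habove t hst (hmax ▸ ht)⟩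

theorem IsMinimal.type_eq (hμ : μ.IsMinimal β) (hν : ν.IsMinimal β) : μ.type = ν.type := by
  rw [type, type, ← hμ.maxSize_eq hν]
  refine List.map_congr_left fun s hs => ?_
  exact hμ.mult_eq hν (Nat.le_add_left 1 s) (List.mem_range.1 hs)

theorem size_le_maxSize (μ : AtomicMeasure) (i : Fin μ.N) : (μ.atom i).size ≤ μ.maxSize :=
  Finset.le_sup (f := fun i => (μ.atom i).size) (Finset.mem_univ i)

theorem size_eq_one_or_two (hμ : μ.maxSize = 2) (i : Fin μ.N) :
    (μ.atom i).size = 1 ∨ (μ.atom i).size = 2 := by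
  have hle := μ.size_le_maxSize i
  have hpos := (μ.atom i).size_pos
  omega

theorem type_of_maxSize_eq_two (hμ : μ.maxSize = 2) : μ.type = [μ.mult 1, μ.mult 2] := by
  rw [type, hμ]
  rfl

theorem mult_one_add_mult_two (hμ : μ.maxSize = 2) : μ.mult 1 + μ.mult 2 = μ.N := by
  have hiff (i : Fin μ.N) : (μ.atom i).size = 2 ↔ ¬ (μ.atom i).size = 1 := by
    have := μ.size_eq_one_or_two hμ i
    omega
  simp only [mult, hiff]
  rw [Finset.card_filter_add_card_filter_not, Finset.card_univ, Fintype.card_fin]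

theorem one_lt_maxSize (h : μ.momentSeq.Noncommutative) : 1 < μ.maxSize := by
  by_contra! hle
  have htrace (i) : (μ.atom i).trace [X, X, Y, Y] = (μ.atom i).trace [X, Y, X, Y] :=
    Atom.trace_XXYY_of_size_le_one ((μ.size_le_maxSize i).trans hle)
  refine h ?_
  change ∑ i, μ.density i * (μ.atom i).trace [X, X, Y, Y] =
    ∑ i, μ.density i * (μ.atom i).trace [X, Y, X, Y]
  simp only [htrace]

end AtomicMeasure

/-! ### The minimal measure -/

/-- The irreducible atoms on the hyperbola of size at most two, the one of size two being fixed by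
its parameter `α`. -/
noncomputable def modelAtom (α : ℝ) : Fin 3 → Atom :=
  ![pointAtom 1, pointAtom (-1), planeAtom α]

theorem hyperbolicPair_modelAtom (α : ℝ) (j : Fin 3) :
    HyperbolicPair (modelAtom α j).A (modelAtom α j).B := by
  fin_cases j
  · exact hyperbolicPair_point (one_mul 1)
  · exact hyperbolicPair_point (neg_mul_neg 1 1 |>.trans (one_mul 1))
  · exact hyperbolicPair_plane α

theorem AtomicMeasure.exists_class {ν : AtomicMeasure}
    (hν : ∀ i, HyperbolicPair (ν.atom i).A (ν.atom i).B) (hXX : ν.momentSeq.moment [X, X] ≠ 0)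
    (hmax : ν.maxSize = 2) (hmult : ν.mult 2 = 1) :
    ∃ α > 0, ∃ κ : Fin ν.N → Fin 3, ∀ i, (modelAtom α (κ i)).OrthEquiv (ν.atom i) := by
  obtain ⟨i₂, hi₂⟩ := Finset.card_eq_one.1 hmult
  have hsize (i) : (ν.atom i).size = 2 ↔ i = i₂ := by
    simpa using Finset.ext_iff.1 hi₂ i
  have hone (i) (hi : i ≠ i₂) : (ν.atom i).size = 1 :=
    (ν.size_eq_one_or_two hmax i).resolve_right (mt (hsize i).1 hi)
  have hA : (ν.atom i₂).A ≠ 0 := by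
    intro hA₂
    have hA (i) : (ν.atom i).A = 0 := by
      rcases eq_or_ne i i₂ with rfl | hi
      · exact hA₂
      · exact Atom.A_eq_zero_of_size_eq_one (hν i) (hone i hi)
    refine hXX ?_
    change ∑ i, ν.density i * (ν.atom i).trace [X, X] = 0
    refine Finset.sum_eq_zero fun i _ => ?_
    rw [Atom.trace_XX, hA, mul_zero, trace_zero, zero_div, mul_zero]
  obtain ⟨α, hα, hplane⟩ := Atom.exists_planeAtom_orthEquiv (hν i₂) ((hsize i₂).2 rfl) hA
  have hex (i) : ∃ j, (modelAtom α j).OrthEquiv (ν.atom i) := by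
    rcases eq_or_ne i i₂ with rfl | hi
    · exact ⟨2, hplane⟩
    · rcases Atom.pointAtom_orthEquiv_of_size_eq_one (hν i) (hone i hi) with h | h
      · exact ⟨0, h⟩
      · exact ⟨1, h⟩
  choose κ hκ using hex
  exact ⟨α, hα, κ, hκ⟩

namespace TracialSeq

variable (β : TracialSeq)

/-- The parameter of the atom of size two in the minimal measure of `β`. -/
noncomputable def planeParam : ℝ :=
  √(β.moment [X, X, X, X] / β.moment [X, X])

/-- The weights of the three model atoms in the minimal measure of `β`. -/
noncomputable def minimalWeight : Fin 3 → ℝ :=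
  let q := β.moment [X, X] ^ 2 / β.moment [X, X, X, X]
  ![(1 - q + β.moment [Y]) / 2, (1 - q - β.moment [Y]) / 2, q]

variable {β}

/-- The system expresses that the model atoms with weights `p` reproduce the moments of
`1, Y, X², X⁴`. -/
theorem eq_planeParam_and_eq_minimalWeight_iff (ha : 0 < β.moment [X, X])
    (hc : 0 < β.moment [X, X, X, X]) {α : ℝ} (hα : 0 < α) {p : Fin 3 → ℝ} :
    α = β.planeParam ∧ p = β.minimalWeight ↔
      p 0 + p 1 + p 2 = 1 ∧ p 0 - p 1 = β.moment [Y] ∧ p 2 * α ^ 2 = β.moment [X, X] ∧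
        p 2 * α ^ 4 = β.moment [X, X, X, X] := by
  set a := β.moment [X, X]
  set c := β.moment [X, X, X, X]
  set y := β.moment [Y]
  constructor
  · rintro ⟨hαβ, rfl⟩
    have hα2 : α ^ 2 = c / a := by rw [hαβ, planeParam, Real.sq_sqrt (by positivity)]
    refine ⟨?_, ?_, ?_, ?_⟩
    · change (1 - a ^ 2 / c + y) / 2 + (1 - a ^ 2 / c - y) / 2 + a ^ 2 / c = 1
      ring
    · change (1 - a ^ 2 / c + y) / 2 - (1 - a ^ 2 / c - y) / 2 = y
      ring
    · change a ^ 2 / c * α ^ 2 = a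
      rw [hα2]
      field_simp
    · change a ^ 2 / c * α ^ 4 = c
      rw [show α ^ 4 = (α ^ 2) ^ 2 by ring, hα2]
      field_simp
  · rintro ⟨hsum, hY, hXX, hXXXX⟩
    have hα2 : α ^ 2 = c / a := by
      rw [eq_div_iff ha.ne', ← hXXXX, ← hXX]
      ring
    have hp2 : p 2 = a ^ 2 / c := by
      rw [eq_div_iff hc.ne', ← hXXXX, ← hXX]
      ring
    have hp0 : p 0 = (1 - a ^ 2 / c + y) / 2 := by linarith
    have hp1 : p 1 = (1 - a ^ 2 / c - y) / 2 := by linarith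
    refine ⟨by rw [planeParam, ← hα2, Real.sqrt_sq hα.le], ?_⟩
    ext j
    fin_cases j
    exacts [hp0, hp1, hp2]

theorem minimalWeight_mem_stdSimplex (hc : 0 < β.moment [X, X, X, X])
    (hle : β.moment [X, X] ^ 2 ≤ β.moment [X, X, X, X] * (1 - |β.moment [Y]|)) :
    β.minimalWeight ∈ stdSimplex ℝ (Fin 3) := by
  have hq : β.moment [X, X] ^ 2 / β.moment [X, X, X, X] ≤ 1 - |β.moment [Y]| :=
    (div_le_iff₀' hc).2 hle
  have hle_abs := le_abs_self (β.moment [Y])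
  have hneg_abs := neg_abs_le (β.moment [Y])
  constructor
  · intro j
    fin_cases j
    · change 0 ≤ (1 - β.moment [X, X] ^ 2 / β.moment [X, X, X, X] + β.moment [Y]) / 2
      linarith
    · change 0 ≤ (1 - β.moment [X, X] ^ 2 / β.moment [X, X, X, X] - β.moment [Y]) / 2
      linarith
    · change 0 ≤ β.moment [X, X] ^ 2 / β.moment [X, X, X, X]
      positivity
  · rw [Fin.sum_univ_three]
    simp only [minimalWeight, cons_val]
    ring

theorem minimalWeight_two_ne_zero (ha : β.moment [X, X] ≠ 0) (hc : β.moment [X, X, X, X] ≠ 0) :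
    β.minimalWeight 2 ≠ 0 :=
  div_ne_zero (pow_ne_zero 2 ha) hc

theorem minimalWeight_ne_zero (hc : 0 < β.moment [X, X, X, X])
    (hlt : β.moment [X, X] ^ 2 < β.moment [X, X, X, X] * (1 - |β.moment [Y]|)) :
    β.minimalWeight 0 ≠ 0 ∧ β.minimalWeight 1 ≠ 0 := by
  have hq : β.moment [X, X] ^ 2 / β.moment [X, X, X, X] < 1 - |β.moment [Y]| :=
    (div_lt_iff₀' hc).2 hlt
  have hle_abs := le_abs_self (β.moment [Y])
  have hneg_abs := neg_abs_le (β.moment [Y])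
  simp only [minimalWeight, cons_val]
  constructor <;> apply ne_of_gt <;> linarith

theorem minimalWeight_zero_eq_zero_iff (hc : 0 < β.moment [X, X, X, X])
    (hY : β.moment [Y] ≠ 0)
    (heq : β.moment [X, X] ^ 2 = β.moment [X, X, X, X] * (1 - |β.moment [Y]|)) :
    β.minimalWeight 0 = 0 ↔ β.minimalWeight 1 ≠ 0 := by
  have hq : β.moment [X, X] ^ 2 / β.moment [X, X, X, X] = 1 - |β.moment [Y]| :=
    (div_eq_iff hc.ne').2 (heq.trans (mul_comm _ _))
  simp only [minimalWeight, cons_val, hq]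
  rcases lt_or_gt_of_ne hY with h | h
  · rw [abs_of_neg h]
    exact iff_of_true (by ring) (ne_of_gt (by linarith))
  · rw [abs_of_pos h]
    exact iff_of_false (ne_of_gt (by linarith)) (not_not.2 (by ring))

variable (β) in
/-- The minimal measure of `β`, given that its weights form a probability vector. -/
noncomputable def minimalMeasure (hp : β.minimalWeight ∈ stdSimplex ℝ (Fin 3)) :
    AtomicMeasure :=
  .ofWeights (modelAtom β.planeParam) hp

end TracialSeq

theorem sum_mul_trace_modelAtom (p : Fin 3 → ℝ) (α : ℝ) :
    ∑ j, p j * (modelAtom α j).trace [] = p 0 + p 1 + p 2 ∧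
    ∑ j, p j * (modelAtom α j).trace [Y] = p 0 - p 1 ∧
    ∑ j, p j * (modelAtom α j).trace [X, X] = p 2 * α ^ 2 ∧
    ∑ j, p j * (modelAtom α j).trace [X, X, X, X] = p 2 * α ^ 4 := by
  simp [Fin.sum_univ_three, modelAtom, Atom.trace_nil, trace_pointAtom_Y, trace_pointAtom_XX,
    trace_pointAtom_XXXX, trace_planeAtom_Y, trace_planeAtom_XX, trace_planeAtom_XXXX,
    sub_eq_add_neg]

namespace TracialSeq

open AtomicMeasure

variable {β : TracialSeq}

section MinimalMeasure

variable (hp : β.minimalWeight ∈ stdSimplex ℝ (Fin 3))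

theorem represents_minimalMeasure (hβ : β.ColumnRelations) (hnorm : β.Normalized)
    (hX : β.moment [X] = 0) (ha : 0 < β.moment [X, X]) (hc : 0 < β.moment [X, X, X, X]) :
    (β.minimalMeasure hp).Represents β := by
  have hyperbolic (i) := hyperbolicPair_modelAtom β.planeParam (supportIndex β.minimalWeight i)
  have hα : 0 < β.planeParam := Real.sqrt_pos.2 (div_pos hc ha)
  have hmoment := moment_ofWeights (atom := modelAtom β.planeParam) hp
  obtain ⟨-, hY, hXX, hXXXX⟩ := (eq_planeParam_and_eq_minimalWeight_iff ha hc hα).1 ⟨rfl, rfl⟩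
  obtain ⟨-, sY, sXX, sXXXX⟩ := sum_mul_trace_modelAtom β.minimalWeight β.planeParam
  refine represents_iff_momentSeq_eq.2 (ColumnRelations.ext
    ((columnRelations_momentSeq_iff _).2 hyperbolic) hβ ?_ ?_ ?_ ?_ ?_)
  · exact (normalized_momentSeq _).trans hnorm.symm
  · exact (moment_X_eq_zero hyperbolic).trans hX.symm
  · exact (hmoment _ _).trans (sY.trans hY)
  · exact (hmoment _ _).trans (sXX.trans hXX)
  · exact (hmoment _ _).trans (sXXXX.trans hXXXX)

theorem mult_one_minimalMeasure : (β.minimalMeasure hp).mult 1 =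
    (if β.minimalWeight 0 = 0 then 0 else 1) + if β.minimalWeight 1 = 0 then 0 else 1 := by
  rw [minimalMeasure, mult_ofWeights, Finset.card_filter, Fin.sum_univ_three]
  simp [modelAtom, pointAtom, planeAtom]

theorem mult_two_minimalMeasure (h : β.minimalWeight 2 ≠ 0) :
    (β.minimalMeasure hp).mult 2 = 1 := by
  rw [minimalMeasure, mult_ofWeights, Finset.card_filter, Fin.sum_univ_three]
  simp [modelAtom, pointAtom, planeAtom, h]

theorem maxSize_minimalMeasure_le : (β.minimalMeasure hp).maxSize ≤ 2 := by
  have hsize (j) : (modelAtom β.planeParam j).size ≤ 2 := by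
    fin_cases j <;> simp [modelAtom, pointAtom, planeAtom]
  exact Finset.sup_le fun i _ => hsize _

end MinimalMeasure

theorem exists_class_of_represents {ν : AtomicMeasure} (hν : ν.Represents β)
    (hβ : β.ColumnRelations) (ha : 0 < β.moment [X, X]) (hc : 0 < β.moment [X, X, X, X])
    (hmax : ν.maxSize = 2) (hmult : ν.mult 2 = 1) :
    ∃ κ : Fin ν.N → Fin 3, ν.classWeight κ = β.minimalWeight ∧
      ∀ i, (modelAtom β.planeParam (κ i)).OrthEquiv (ν.atom i) := by
  obtain rfl := represents_iff_momentSeq_eq.1 hν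
  obtain ⟨α, hα, κ, hκ⟩ :=
    exists_class ((columnRelations_momentSeq_iff ν).1 hβ) ha.ne' hmax hmult
  have hmoment := moment_eq_sum_classWeight hκ
  obtain ⟨s1, sY, sXX, sXXXX⟩ := sum_mul_trace_modelAtom (ν.classWeight κ) α
  obtain ⟨rfl, hweight⟩ := (eq_planeParam_and_eq_minimalWeight_iff ha hc hα).2
    ⟨s1.symm.trans ((hmoment [] (by decide)).symm.trans (normalized_momentSeq ν)),
      sY.symm.trans (hmoment _ _).symm, sXX.symm.trans (hmoment _ _).symm,
      sXXXX.symm.trans (hmoment _ _).symm⟩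
  exact ⟨κ, hweight, hκ⟩

theorem maxSize_minimalMeasure (hnc : β.Noncommutative)
    (hp : β.minimalWeight ∈ stdSimplex ℝ (Fin 3)) (hrep : (β.minimalMeasure hp).Represents β) :
    (β.minimalMeasure hp).maxSize = 2 :=
  le_antisymm (maxSize_minimalMeasure_le hp)
    (one_lt_maxSize (by rwa [represents_iff_momentSeq_eq.1 hrep]))

theorem isMinimal_minimalMeasure (hβ : β.ColumnRelations) (hnc : β.Noncommutative)
    (ha : 0 < β.moment [X, X]) (hc : 0 < β.moment [X, X, X, X])
    (hp : β.minimalWeight ∈ stdSimplex ℝ (Fin 3)) (hrep : (β.minimalMeasure hp).Represents β) :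
    (β.minimalMeasure hp).IsMinimal β := by
  have hmax := maxSize_minimalMeasure hnc hp hrep
  have hmult := mult_two_minimalMeasure hp (minimalWeight_two_ne_zero ha.ne' hc.ne')
  refine ⟨hrep, fun ν hν hlt => ?_⟩
  have hνmax : 1 < ν.maxSize := one_lt_maxSize (by rwa [represents_iff_momentSeq_eq.1 hν])
  rcases hlt with hlt | ⟨hmaxeq, s, hs, hsr, hlt, habove⟩
  · omega
  rw [hmax] at hmaxeq hsr habove
  obtain rfl | rfl : s = 1 ∨ s = 2 := by omega
  · obtain ⟨κ, hw, hκ⟩ := exists_class_of_represents hν hβ ha hc hmaxeq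
      ((habove 2 one_lt_two le_rfl).trans hmult)
    exact hlt.not_ge (mult_ofWeights_le hp hw hκ 1)
  · have hpos := ν.mult_maxSize_pos
    rw [hmaxeq] at hpos
    omega

theorem minimalMeasure_orthEquiv (hβ : β.ColumnRelations) (hnc : β.Noncommutative)
    (ha : 0 < β.moment [X, X]) (hc : 0 < β.moment [X, X, X, X])
    (hp : β.minimalWeight ∈ stdSimplex ℝ (Fin 3)) (hmin : (β.minimalMeasure hp).IsMinimal β)
    {ν : AtomicMeasure} (hν : ν.IsMinimal β) : (β.minimalMeasure hp).OrthEquiv ν := by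
  have hmax := maxSize_minimalMeasure hnc hp hmin.1
  have hνmax : ν.maxSize = 2 := (hmin.maxSize_eq hν).symm.trans hmax
  have hmult₁ := hmin.mult_eq hν le_rfl (hmax ▸ one_le_two)
  have hmult₂ := hmin.mult_eq hν one_le_two hmax.ge
  obtain ⟨κ, hw, hκ⟩ := exists_class_of_represents hν.1 hβ ha hc hνmax
    (hmult₂.symm.trans (mult_two_minimalMeasure hp (minimalWeight_two_ne_zero ha.ne' hc.ne')))
  have hN : (β.minimalMeasure hp).N = ν.N := by
    rw [← mult_one_add_mult_two hmax, ← mult_one_add_mult_two hνmax, hmult₁, hmult₂]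
  exact ofWeights_orthEquiv hp hw hκ hN

variable (β) in
/-- The criterion for a sequence on the hyperbola to have a representing measure. -/
structure Admissible : Prop where
  posSemidef : β.M₂.PosSemidef
  moment_X : β.moment [X] = 0
  sq_moment_XX_le :
    β.moment [X, X] ^ 2 ≤ β.moment [X, X, X, X] * (1 - |β.moment [Y]|)

theorem ColumnRelations.admissible_of_represents (hβ : β.ColumnRelations) {μ : AtomicMeasure}
    (hμ : μ.Represents β) : β.Admissible := by
  obtain rfl := represents_iff_momentSeq_eq.1 hμ
  have hyperbolic := (columnRelations_momentSeq_iff μ).1 hβ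
  exact ⟨posSemidef_M₂ μ, moment_X_eq_zero hyperbolic, AtomicMeasure.sq_moment_XX_le hyperbolic⟩

section RankFive

variable (hβ : β.ColumnRelations) (hrank : β.M₂.rank = 5) (hnorm : β.Normalized)
include hβ hrank hnorm

theorem ColumnRelations.moment_XXXX_pos (hM : β.M₂.PosSemidef) : 0 < β.moment [X, X, X, X] :=
  (sq_nonneg _).trans_lt (hβ.sq_moment_XX_lt hrank hM hnorm)

theorem ColumnRelations.sq_moment_XX_lt_of_moment_Y_eq_zero (hM : β.M₂.PosSemidef)
    (hY : β.moment [Y] = 0) :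
    β.moment [X, X] ^ 2 < β.moment [X, X, X, X] * (1 - |β.moment [Y]|) := by
  rw [hY, abs_zero, sub_zero, mul_one]
  exact hβ.sq_moment_XX_lt hrank hM hnorm

theorem ColumnRelations.condTwo_iff (hM : β.M₂.PosSemidef) :
    β.CondTwo ↔ β.Admissible ∧ β.moment [Y] ≠ 0 := by
  have ha := hβ.moment_XX_pos hrank hM
  have hc := hβ.moment_XXXX_pos hrank hnorm hM
  constructor
  · rintro ⟨hX, hY, hY1, hle⟩
    exact ⟨⟨hM, hX, (div_le_iff₀ (sub_pos.2 hY1)).1 hle⟩, abs_pos.1 hY⟩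
  · rintro ⟨h, hY⟩
    have hY1 : 0 < 1 - |β.moment [Y]| :=
      pos_of_mul_pos_right ((pow_pos ha 2).trans_le h.sq_moment_XX_le) hc.le
    exact ⟨h.moment_X, abs_pos.2 hY, sub_pos.1 hY1, (div_le_iff₀ hY1).2 h.sq_moment_XX_le⟩

variable (hnc : β.Noncommutative)
include hnc

theorem Admissible.exists_isMinimal (h : β.Admissible) :
    ∃ hp, (β.minimalMeasure hp).IsMinimal β := by
  have ha := hβ.moment_XX_pos hrank h.posSemidef
  have hc := hβ.moment_XXXX_pos hrank hnorm h.posSemidef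
  have hp := minimalWeight_mem_stdSimplex hc h.sq_moment_XX_le
  exact ⟨hp, isMinimal_minimalMeasure hβ hnc ha hc hp
    (represents_minimalMeasure hp hβ hnorm h.moment_X ha hc)⟩

theorem Admissible.hasUniqueMinimalMeasure (h : β.Admissible) : β.HasUniqueMinimalMeasure := by
  obtain ⟨hp, hmin⟩ := h.exists_isMinimal hβ hrank hnorm hnc
  have ha := hβ.moment_XX_pos hrank h.posSemidef
  have hc := hβ.moment_XXXX_pos hrank hnorm h.posSemidef
  exact ⟨_, hmin, fun ν hν => minimalMeasure_orthEquiv hβ hnc ha hc hp hmin hν⟩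

theorem ColumnRelations.admitsNCMeasure_iff : β.AdmitsNCMeasure ↔ β.Admissible := by
  constructor
  · rintro ⟨μ, hμ, -⟩
    exact hβ.admissible_of_represents hμ.1
  · intro h
    obtain ⟨hp, hmin⟩ := h.exists_isMinimal hβ hrank hnorm hnc
    exact ⟨_, hmin, (maxSize_minimalMeasure hnc hp hmin.1).symm ▸ one_lt_two⟩

variable {μ : AtomicMeasure} (hμ : μ.IsMinimal β)
include hμ

theorem ColumnRelations.type_eq_of_isMinimal :
    μ.type = [(if β.minimalWeight 0 = 0 then 0 else 1) +
      if β.minimalWeight 1 = 0 then 0 else 1, 1] := by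
  have h := hβ.admissible_of_represents hμ.1
  obtain ⟨hp, hmin⟩ := h.exists_isMinimal hβ hrank hnorm hnc
  have ha := hβ.moment_XX_pos hrank h.posSemidef
  have hc := hβ.moment_XXXX_pos hrank hnorm h.posSemidef
  rw [hμ.type_eq hmin, type_of_maxSize_eq_two (maxSize_minimalMeasure hnc hp hmin.1),
    mult_one_minimalMeasure,
    mult_two_minimalMeasure hp (minimalWeight_two_ne_zero ha.ne' hc.ne')]

theorem ColumnRelations.type_eq_two_one
    (hlt : β.moment [X, X] ^ 2 < β.moment [X, X, X, X] * (1 - |β.moment [Y]|)) :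
    μ.type = [2, 1] := by
  have hM := (hβ.admissible_of_represents hμ.1).posSemidef
  obtain ⟨h₀, h₁⟩ := minimalWeight_ne_zero (hβ.moment_XXXX_pos hrank hnorm hM) hlt
  rw [hβ.type_eq_of_isMinimal hrank hnorm hnc hμ, if_neg h₀, if_neg h₁]

theorem ColumnRelations.type_eq_one_one_iff (hY : β.moment [Y] ≠ 0) :
    μ.type = [1, 1] ↔
      β.moment [X, X] ^ 2 = β.moment [X, X, X, X] * (1 - |β.moment [Y]|) := by
  have h := hβ.admissible_of_represents hμ.1
  constructor
  · intro htype
    by_contra hne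
    have htwo := hβ.type_eq_two_one hrank hnorm hnc hμ (h.sq_moment_XX_le.lt_of_ne hne)
    simp [htwo] at htype
  · intro heq
    have hiff := minimalWeight_zero_eq_zero_iff (hβ.moment_XXXX_pos hrank hnorm h.posSemidef)
      hY heq
    rw [hβ.type_eq_of_isMinimal hrank hnorm hnc hμ]
    by_cases h₁ : β.minimalWeight 1 = 0 <;> simp [hiff, h₁]

end RankFive

end TracialSeq

end BQTMP

open BQTMP BQTMP.Letter in
theorem theorem6p10 (β : TracialSeq) (hnorm : β.Normalized) (hnc : β.Noncommutative)
    (hrank : β.M₂.rank = 5)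
    (hrel₁ : β.column [X, Y] + β.column [Y, X] = 0)
    (hrel₂ : β.column [Y, Y] - β.column [X, X] = β.column []) :
    (β.AdmitsNCMeasure ↔
      (β.M₂.PosSemidef ∧ β.moment [X] = 0 ∧ β.moment [Y] = 0) ∨
      (β.M₂.PosSemidef ∧ β.CondTwo)) ∧
    (β.M₂.PosSemidef → β.moment [X] = 0 → β.moment [Y] = 0 →
      β.HasUniqueMinimalMeasure ∧
      ∀ μ : AtomicMeasure, μ.IsMinimal β → μ.type = [2, 1]) ∧
    (β.M₂.PosSemidef → β.CondTwo →
      β.HasUniqueMinimalMeasure ∧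
      ∀ μ : AtomicMeasure, μ.IsMinimal β →
        (μ.type = [1, 1] ↔
          β.moment [X, X, X, X] = β.moment [X, X] ^ 2 / (1 - |β.moment [Y]|)) ∧
        (β.moment [X, X, X, X] ≠ β.moment [X, X] ^ 2 / (1 - |β.moment [Y]|) →
          μ.type = [2, 1])) := by
  have hβ : β.ColumnRelations := ⟨hrel₁, hrel₂⟩
  have hstrict (hM : β.M₂.PosSemidef) := hβ.sq_moment_XX_lt_of_moment_Y_eq_zero hrank hnorm hM
  have hcondTwo (hM : β.M₂.PosSemidef) := hβ.condTwo_iff hrank hnorm hM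
  refine ⟨(hβ.admitsNCMeasure_iff hrank hnorm hnc).trans ⟨fun h => ?_, ?_⟩, ?_, ?_⟩
  · by_cases hY : β.moment [Y] = 0
    · exact .inl ⟨h.posSemidef, h.moment_X, hY⟩
    · exact .inr ⟨h.posSemidef, (hcondTwo h.posSemidef).2 ⟨h, hY⟩⟩
  · rintro (⟨hM, hX, hY⟩ | ⟨hM, htwo⟩)
    · exact ⟨hM, hX, (hstrict hM hY).le⟩
    · exact ((hcondTwo hM).1 htwo).1
  · intro hM hX hY
    have h : β.Admissible := ⟨hM, hX, (hstrict hM hY).le⟩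
    exact ⟨h.hasUniqueMinimalMeasure hβ hrank hnorm hnc,
      fun μ hμ => hβ.type_eq_two_one hrank hnorm hnc hμ (hstrict hM hY)⟩
  · intro hM htwo
    obtain ⟨h, hY⟩ := (hcondTwo hM).1 htwo
    have hdiv : β.moment [X, X, X, X] = β.moment [X, X] ^ 2 / (1 - |β.moment [Y]|) ↔ _ :=
      (eq_div_iff (sub_pos.2 htwo.2.2.1).ne').trans eq_comm
    exact ⟨h.hasUniqueMinimalMeasure hβ hrank hnorm hnc, fun μ hμ =>
      ⟨(hβ.type_eq_one_one_iff hrank hnorm hnc hμ hY).trans hdiv.symm, fun hne =>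
        hβ.type_eq_two_one hrank hnorm hnc hμ (h.sq_moment_XX_le.lt_of_ne (mt hdiv.2 hne))⟩⟩
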